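/- Let $\mathbb{P}_{\mathbb{N}}$ be the group of finite permutations of $\mathbb{N}$ (those moving only finitely many points). Let $(\mathfrak{A},\theta)$ be a quasi-local algebra over the finite subsets of $\mathbb{N}$: a unital $C^*$-algebra $\mathfrak{A}$ with an involutive $*$-automorphism $\theta$ (an element $x$ is even if $\theta(x)=x$, odd if $\theta(x)=-x$, homogeneous if it is even or odd), and unital $C^*$-subalgebras $\mathfrak{A}(I)\subset\mathfrak{A}$ (containing the unit of $\mathfrak{A}$), for finite $I\subset\mathbb{N}$, with dense union, such that $\mathfrak{A}(I)\subset\mathfrak{A}(J)$ if $I\subset J$; $\theta(\mathfrak{A}(I))=\mathfrak{A}(I)$; and, if $I\cap J=\emptyset$, homogeneous $x\in\mathfrak{A}(I)$ and $y\in\mathfrak{A}(J)$ commute when one of them is even and anticommute when both are odd. Let $\alpha:\mathbb{P}_{\mathbb{N}}\to\mathrm{Aut}(\mathfrak{A})$ be a local action, i.e. a group homomorphism with $\alpha_\sigma\circ\theta=\theta\circ\alpha_\sigma$ and $\alpha_\sigma(\mathfrak{A}(I))=\mathfrak{A}(\sigma(I))$ for all $\sigma\in\mathbb{P}_{\mathbb{N}}$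 and all finite $I\subset\mathbb{N}$. Let $\mathcal{S}^{\mathbb{P}_{\mathbb{N}}}(\mathfrak{A})$ be the convex set of states $\omega$ with $\omega\circ\alpha_\sigma=\omega$ for all $\sigma\in\mathbb{P}_{\mathbb{N}}$. For such an $\omega$ with GNS triple $(\mathcal{H}_\omega,\pi_\omega,\xi_\omega)$, let $U^\omega_\sigma$ be the unitary on $\mathcal{H}_\omega$ with $U^\omega_\sigma\pi_\omega(a)\xi_\omega=\pi_\omega(\alpha_\sigma(a))\xi_\omega$ for $a\in\mathfrak{A}$, let $\mathcal{H}_\omega^{\mathbb{P}_{\mathbb{N}}}=\{\xi\in\mathcal{H}_\omega: U^\omega_\sigma\xi=\xi \text{ for all } \sigma\in\mathbb{P}_{\mathbb{N}}\}$, and let $E_\omega$ be the orthogonal projection onto $\mathcal{H}_\omega^{\mathbb{P}_{\mathbb{N}}}$. Then for every $\omega\in\mathcal{S}^{\mathbb{P}_{\mathbb{N}}}(\mathfrak{A})$: 1. $\omega$ is even, i.e. $\omega\circ\theta=\omega$; 2. the operators in $E_\omega\pi_\omega(\mathfrak{A})E_\omega$ commute pairwise; 3. $\omega$ is an extreme point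 of $\mathcal{S}^{\mathbb{P}_{\mathbb{N}}}(\mathfrak{A})$ if and only if $\dim\mathcal{H}_\omega^{\mathbb{P}_{\mathbb{N}}}=1$. Consequently the system $(\mathfrak{A},\mathbb{P}_{\mathbb{N}},\alpha)$ is $\mathbb{P}_{\mathbb{N}}$-abelian, meaning that $E_\omega\pi_\omega(\mathfrak{A})E_\omega$ is a commuting family for every invariant state $\omega$. -/

import Mathlib

open scoped ComplexOrder

/-- The group of finite permutations of `ℕ`: the permutations that move only finitely many
points. -/
def FinPerm : Subgroup (Equiv.Perm ℕ) where
  carrier := {σ | {n | σ n ≠ n}.Finite}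
  one_mem' := by simp
  mul_mem' := by
    intro σ τ hσ hτ
    refine (Set.Finite.union hσ hτ).subset fun n hn => ?_
    by_contra h
    simp only [Set.mem_union, Set.mem_ofPred_eq, not_or, not_not] at h
    exact hn (by rw [Equiv.Perm.mul_apply, h.2, h.1])
  inv_mem' := by
    intro σ hσ
    refine Set.Finite.subset hσ fun n hn h => hn ?_
    rw [Equiv.Perm.inv_eq_iff_eq, h]

/-- A quasi-local algebra structure over the finite subsets of `ℕ` on a unital C⋆-algebra `A`:
an involutive grading automorphism `θ` together with a net of unital C⋆-subalgebras (norm-closed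
⋆-subalgebras containing `1`) whose union is dense in `A`. -/
structure QuasiLocal (A : Type*) [CStarAlgebra A] where
  /-- the grading automorphism -/
  θ : A ≃⋆ₐ[ℂ] A
  /-- the local algebras -/
  loc : Finset ℕ → StarSubalgebra ℂ A
  θ_involutive : ∀ a, θ (θ a) = a
  isClosed_loc : ∀ I, IsClosed (loc I : Set A)
  dense_iUnion_loc : Dense (⋃ I, (loc I : Set A))
  loc_mono : ∀ I J, I ⊆ J → loc I ≤ loc J
  θ_image_loc : ∀ I, θ '' (loc I : Set A) = loc I
  /-- disjointly localized homogeneous elements commute if one of them is even -/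
  comm_of_even : ∀ I J, Disjoint I J → ∀ x ∈ loc I, ∀ y ∈ loc J,
    (θ x = x ∨ θ x = -x) → (θ y = y ∨ θ y = -y) → (θ x = x ∨ θ y = y) → x * y = y * x
  /-- disjointly localized odd elements anticommute -/
  anticomm_of_odd : ∀ I J, Disjoint I J → ∀ x ∈ loc I, ∀ y ∈ loc J,
    θ x = -x → θ y = -y → x * y = -(y * x)

/-- An action of the finite permutations on a quasi-local algebra is local if it is
grading-equivariant and maps `loc I` onto `loc (σ I)`. -/
structure QuasiLocal.IsLocalAction {A : Type*} [CStarAlgebra A] (Q : QuasiLocal A)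
    (α : FinPerm →* (A ≃⋆ₐ[ℂ] A)) : Prop where
  equivariant : ∀ σ a, α σ (Q.θ a) = Q.θ (α σ a)
  image_loc : ∀ (σ : FinPerm) (I : Finset ℕ),
    α σ '' (Q.loc I : Set A) = Q.loc (I.image (σ : Equiv.Perm ℕ))

section States

variable {A : Type*} [CStarAlgebra A] [PartialOrder A]

/-- The states of `A`: positive linear functionals taking the value `1` at `1`. -/
def stateSpace (A : Type*) [CStarAlgebra A] [PartialOrder A] : Set (A →ₗ[ℂ] ℂ) :=
  {φ | (∀ a, 0 ≤ a → 0 ≤ φ a) ∧ φ 1 = 1}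

/-- The states of `A` invariant under an action `α` of a group `G`. -/
def invariantStates {G : Type*} [Group G] (α : G →* (A ≃⋆ₐ[ℂ] A)) : Set (A →ₗ[ℂ] ℂ) :=
  {φ | φ ∈ stateSpace A ∧ ∀ g a, φ (α g a) = φ a}

end States

noncomputable section GNS

variable {A : Type*} [CStarAlgebra A] [PartialOrder A] [StarOrderedRing A]

/-- The isometry `a ↦ β a` of the pre-GNS space of `ω`, for an automorphism `β` preserving `ω`. -/
def preGNSIsometry (ω : A →ₚ[ℂ] ℂ) (β : A ≃⋆ₐ[ℂ] A) (h : ∀ a, ω (β a) = ω a) :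
    ω.PreGNS →ₗᵢ[ℂ] ω.PreGNS where
  toFun x := ω.toPreGNS (β (ω.ofPreGNS x))
  map_add' x y := by simp
  map_smul' c x := by simp
  norm_map' x := by
    change ‖ω.toPreGNS (β (ω.ofPreGNS x))‖ = ‖x‖
    rw [PositiveLinearMap.preGNS_norm_def, PositiveLinearMap.preGNS_norm_def,
      PositiveLinearMap.ofPreGNS_toPreGNS, ← map_star β, ← map_mul β, h]

/-- The extension of `preGNSIsometry` to the GNS space. -/
def gnsMap (ω : A →ₚ[ℂ] ℂ) (β : A ≃⋆ₐ[ℂ] A) (h : ∀ a, ω (β a) = ω a) :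
    ω.GNS →L[ℂ] ω.GNS :=
  (preGNSIsometry ω β h).toContinuousLinearMap.completion

theorem gnsMap_coe (ω : A →ₚ[ℂ] ℂ) (β : A ≃⋆ₐ[ℂ] A) (h : ∀ a, ω (β a) = ω a) (a : A) :
    gnsMap ω β h (ω.toPreGNS a : ω.GNS) = (ω.toPreGNS (β a) : ω.GNS) := by
  simp only [gnsMap, ContinuousLinearMap.completion_apply_coe]
  rfl

theorem gnsMap_gnsMap (ω : A →ₚ[ℂ] ℂ) (β γ : A ≃⋆ₐ[ℂ] A) (h : ∀ a, ω (β a) = ω a)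
    (h2 : ∀ a, ω (γ a) = ω a) (hh : ∀ a, γ (β a) = a) (x : ω.GNS) :
    gnsMap ω γ h2 (gnsMap ω β h x) = x := by
  induction x using UniformSpace.Completion.induction_on with
  | hp => exact isClosed_eq (by fun_prop) (by fun_prop)
  | ih a =>
    rw [← ω.toPreGNS_ofPreGNS a, gnsMap_coe, gnsMap_coe, hh]

theorem norm_gnsMap (ω : A →ₚ[ℂ] ℂ) (β : A ≃⋆ₐ[ℂ] A) (h : ∀ a, ω (β a) = ω a) (x : ω.GNS) :
    ‖gnsMap ω β h x‖ = ‖x‖ := by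
  induction x using UniformSpace.Completion.induction_on with
  | hp => exact isClosed_eq (by fun_prop) (by fun_prop)
  | ih a =>
    simp only [gnsMap, ContinuousLinearMap.completion_apply_coe, UniformSpace.Completion.norm_coe]
    exact (preGNSIsometry ω β h).norm_map a

variable {G : Type*} [Group G]

/-- The unitary `U g` on the GNS space of an invariant state `ω` implementing `α g`;
it is determined by `U g (π a ξ) = π (α g a) ξ`, see `gnsUnitary_apply`. -/
def gnsUnitary (α : G →* (A ≃⋆ₐ[ℂ] A)) (ω : A →ₚ[ℂ] ℂ)
    (hω : ω.toLinearMap ∈ invariantStates α) (g : G) : ω.GNS ≃ₗᵢ[ℂ] ω.GNS where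
  toFun := gnsMap ω (α g) (hω.2 g)
  invFun := gnsMap ω (α g⁻¹) (hω.2 g⁻¹)
  map_add' x y := map_add _ x y
  map_smul' c x := map_smul _ c x
  left_inv := gnsMap_gnsMap _ _ _ _ _ fun a => by
    rw [← StarAlgEquiv.mul_apply, ← map_mul]; simp
  right_inv := gnsMap_gnsMap _ _ _ _ _ fun a => by
    rw [← StarAlgEquiv.mul_apply, ← map_mul]; simp
  norm_map' := norm_gnsMap ω (α g) (hω.2 g)

/-- The cyclic vector of the GNS representation: the class of `1`. -/
def gnsVector (ω : A →ₚ[ℂ] ℂ) : ω.GNS := (ω.toPreGNS 1 : ω.GNS)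

theorem gnsStarAlgHom_gnsVector (ω : A →ₚ[ℂ] ℂ) (a : A) :
    ω.gnsStarAlgHom a (gnsVector ω) = (ω.toPreGNS a : ω.GNS) := by
  simp [gnsVector]

theorem gnsUnitary_apply (α : G →* (A ≃⋆ₐ[ℂ] A)) (ω : A →ₚ[ℂ] ℂ)
    (hω : ω.toLinearMap ∈ invariantStates α) (g : G) (a : A) :
    gnsUnitary α ω hω g (ω.gnsStarAlgHom a (gnsVector ω)) =
      ω.gnsStarAlgHom (α g a) (gnsVector ω) := by
  rw [gnsStarAlgHom_gnsVector, gnsStarAlgHom_gnsVector]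
  exact gnsMap_coe ω (α g) (hω.2 g) a

/-- The closed subspace of the vectors in the GNS space fixed by all the unitaries `U g`. -/
def invariantVectors (α : G →* (A ≃⋆ₐ[ℂ] A)) (ω : A →ₚ[ℂ] ℂ)
    (hω : ω.toLinearMap ∈ invariantStates α) : Submodule ℂ ω.GNS where
  carrier := {ξ | ∀ g, gnsUnitary α ω hω g ξ = ξ}
  add_mem' hx hy g := by rw [map_add, hx g, hy g]
  zero_mem' g := map_zero _
  smul_mem' c x hx g := by rw [map_smul, hx g]

instance completeSpace_invariantVectors (α : G →* (A ≃⋆ₐ[ℂ] A)) (ω : A →ₚ[ℂ] ℂ)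
    (hω : ω.toLinearMap ∈ invariantStates α) : CompleteSpace (invariantVectors α ω hω) := by
  have h : IsClosed {ξ : ω.GNS | ∀ g, gnsUnitary α ω hω g ξ = ξ} := by
    simp only [Set.ofPred_forall]
    exact isClosed_iInter fun g =>
      isClosed_eq (gnsUnitary α ω hω g).continuous continuous_id
  exact IsClosed.completeSpace_coe (hs := h)

/-- The orthogonal projection `E` of the GNS space onto the invariant vectors. -/
def invariantProj (α : G →* (A ≃⋆ₐ[ℂ] A)) (ω : A →ₚ[ℂ] ℂ)
    (hω : ω.toLinearMap ∈ invariantStates α) : ω.GNS →L[ℂ] ω.GNS :=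
  (invariantVectors α ω hω).starProjection

/-- The family `E π(A) E` of operators on the GNS space. -/
def compressedFamily (α : G →* (A ≃⋆ₐ[ℂ] A)) (ω : A →ₚ[ℂ] ℂ)
    (hω : ω.toLinearMap ∈ invariantStates α) : Set (ω.GNS →L[ℂ] ω.GNS) :=
  {T | ∃ a : A, T = invariantProj α ω hω * ω.gnsStarAlgHom a * invariantProj α ω hω}

/-- The system `(A, G, α)` is `G`-abelian: for every invariant state, `E π(A) E` is a commuting
family of operators. -/
def IsGAbelian (α : G →* (A ≃⋆ₐ[ℂ] A)) : Prop :=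
  ∀ (ω : A →ₚ[ℂ] ℂ) (hω : ω.toLinearMap ∈ invariantStates α),
    ∀ S ∈ compressedFamily α ω hω, ∀ T ∈ compressedFamily α ω hω, S * T = T * S

end GNS

/-! By the mean ergodic theorem, `E v` is a limit of convex combinations of translates `U g v`. A
finite permutation `h` moves any finite set off any other, and `E v` is fixed by `U h`, so the
translates may be restricted to those `g` that make `α g b` disjointly localized from a given local
`a`. There `a` and `α g b` commute or anticommute, and this passes to the limit as a relation
between `π(a) E π(b)` and `π(b) E π(a)` on invariant vectors (`inner_gnsStarAlgHom_invariantProj`).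

For odd selfadjoint `a = b` it reads `‖E π(b) ζ‖² = -‖E π(b) ζ‖²`, so odd elements compress to zero:
invariant states are even, and only even elements matter for commutativity. For these the relation
gives `E π(a) E π(b) E = E π(b) E π(a) E`, and density extends it to all of `A`.

If the invariant vectors form a line, a component of a convex decomposition of `ω` is dominated by a
multiple of `ω`, hence represented by an invariant vector, hence equal to `ω`. Conversely, commuting
positive compressions have a positive product, so `0 ≤ c ≤ 1` splits `ω` into invariant positive
functionals; extremality forces `E π(c) ξ` into `ℂ ξ`, and cyclicity of `ξ` finishes. -/

/-! ### Mean ergodic theorem for unitary representations -/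

section Ergodic

open scoped InnerProductSpace

variable {H G : Type*} [NormedAddCommGroup H] [InnerProductSpace ℂ H] [CompleteSpace H] [Group G]

/-- The closed convex hull of an orbit of a unitary representation contains a fixed vector. -/
theorem exists_fixed_mem_closure_convexHull (U : G → H ≃ₗᵢ[ℂ] H)
    (hU : ∀ g h x, U (g * h) x = U g (U h x)) (v : H) :
    ∃ w ∈ closure (convexHull ℝ (Set.range fun g => U g v)), ∀ g, U g w = w := by
  let : InnerProductSpace ℝ H := InnerProductSpace.rclikeToReal ℂ H
  set C := closure (convexHull ℝ (Set.range fun g => U g v)) with hC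
  have hconv : Convex ℝ C := (convex_convexHull ℝ _).closure
  have hne : C.Nonempty :=
    ⟨U 1 v, subset_closure (subset_convexHull ℝ _ (Set.mem_range_self 1))⟩
  obtain ⟨w, hw, hmin⟩ := exists_norm_eq_iInf_of_complete_convex hne
    isClosed_closure.isComplete hconv 0
  -- The variational inequality for the point `w` of least norm. Tested at `U g w`, which has the
  -- same norm as `w`, it gives `‖U g w - w‖² ≤ 0`.
  rw [norm_eq_iInf_iff_real_inner_le_zero hconv hw] at hmin
  refine ⟨w, hw, fun g => ?_⟩
  have hmaps : Set.MapsTo (U g) C C := by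
    refine Set.MapsTo.closure (fun x hx => ?_) (U g).continuous
    have h1 : U g x ∈ (((U g : H ≃ₗ[ℂ] H) : H →ₗ[ℂ] H).restrictScalars ℝ) ''
        convexHull ℝ (Set.range fun g => U g v) := ⟨x, hx, rfl⟩
    rw [LinearMap.image_convexHull] at h1
    refine convexHull_mono ?_ h1
    rintro _ ⟨_, ⟨k, rfl⟩, rfl⟩
    exact ⟨g * k, hU g k v⟩
  have h2 := hmin _ (hmaps hw)
  have h3 : ‖U g w - w‖ ^ 2 ≤ 0 := by
    have h4 := norm_sub_sq_real (U g w) w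
    rw [(U g).norm_map] at h4
    rw [zero_sub, inner_neg_left, inner_sub_right, real_inner_self_eq_norm_sq,
      real_inner_comm] at h2
    linarith
  have h5 : ‖U g w - w‖ = 0 := by
    have := norm_nonneg (U g w - w)
    nlinarith
  exact sub_eq_zero.mp (norm_eq_zero.mp h5)

/-- The mean ergodic theorem of Alaoglu and Birkhoff: the projection `p` of `v` onto the fixed
vectors lies in the closed convex hull of the orbit. -/
theorem mem_closure_convexHull_range (U : G → H ≃ₗᵢ[ℂ] H)
    (hU : ∀ g h x, U (g * h) x = U g (U h x)) {v p : H} (hp : ∀ g, U g p = p)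
    (hvp : ∀ z, (∀ g, U g z = z) → ⟪z, v - p⟫_ℂ = 0) :
    p ∈ closure (convexHull ℝ (Set.range fun g => U g v)) := by
  obtain ⟨w, hw, hfix⟩ := exists_fixed_mem_closure_convexHull U hU v
  set z := w - p with hz
  have hzfix : ∀ g, U g z = z := fun g => by rw [hz, map_sub, hfix, hp]
  -- Since `z` is fixed, pairing with `z` is constant on the orbit, hence on its closed convex hull.
  have hsub : closure (convexHull ℝ (Set.range fun g => U g v)) ⊆
      {x | ⟪z, x⟫_ℂ = ⟪z, v⟫_ℂ} := by
    refine closure_minimal (convexHull_min ?_ ?_) (isClosed_eq (by fun_prop) (by fun_prop))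
    · rintro _ ⟨g, rfl⟩
      change ⟪z, U g v⟫_ℂ = _
      conv_lhs => rw [← hzfix g]
      exact (U g).inner_map_map z v
    · intro x hx y hy a b _ _ hab
      have hab' : (a : ℂ) + b = 1 := by exact_mod_cast hab
      simp only [Set.mem_ofPred_eq] at hx hy ⊢
      rw [inner_add_right, ← Complex.coe_smul, ← Complex.coe_smul, inner_smul_right,
        inner_smul_right, hx, hy, ← add_mul, hab', one_mul]
  have h1 : ⟪z, w⟫_ℂ = ⟪z, v⟫_ℂ := hsub hw
  have h2 := hvp z hzfix
  have h3 : ⟪z, z⟫_ℂ = 0 := by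
    rw [inner_sub_right] at h2
    conv_lhs => rw [hz, inner_sub_right, ← hz, h1, h2]
  have h4 : w = p := sub_eq_zero.mp (inner_self_eq_zero.mp h3)
  exact h4 ▸ hw

/-- In the mean ergodic theorem the averages may be taken over any set of group elements that
contains a translate of each finite set. -/
theorem mem_closure_convexHull_image (U : G → H ≃ₗᵢ[ℂ] H)
    (hU : ∀ g h x, U (g * h) x = U g (U h x)) {v p : H} (hp : ∀ g, U g p = p)
    (hvp : ∀ z, (∀ g, U g z = z) → ⟪z, v - p⟫_ℂ = 0) (S : Set G)
    (hS : ∀ F : Finset G, ∃ h, ∀ g ∈ F, h * g ∈ S) :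
    p ∈ closure (convexHull ℝ ((fun g => U g v) '' S)) := by
  classical
  have hmem := mem_closure_convexHull_range U hU hp hvp
  rw [Metric.mem_closure_iff] at hmem ⊢
  intro ε hε
  obtain ⟨x, hx, hxε⟩ := hmem ε hε
  rw [convexHull_eq_union_convexHull_finite_subsets] at hx
  simp only [Set.mem_iUnion] at hx
  obtain ⟨t, ht, hx⟩ := hx
  rw [← Set.image_univ] at ht
  obtain ⟨F, -, rfl⟩ := Finset.subset_set_image_iff.mp ht
  obtain ⟨h, hh⟩ := hS F
  -- `U h` is isometric and fixes `p`, so it moves the approximating convex combination into the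
  -- hull over `S` at no cost in distance.
  refine ⟨U h x, ?_, ?_⟩
  · have h1 : U h x ∈ (((U h : H ≃ₗ[ℂ] H) : H →ₗ[ℂ] H).restrictScalars ℝ) ''
        convexHull ℝ (F.image fun g => U g v : Finset H) := ⟨x, hx, rfl⟩
    rw [LinearMap.image_convexHull] at h1
    refine convexHull_mono ?_ h1
    rintro _ ⟨_, hy, rfl⟩
    obtain ⟨g, hg, rfl⟩ := Finset.mem_image.mp (Finset.mem_coe.mp hy)
    exact ⟨h * g, hh g hg, hU h g v⟩
  · rw [← hp h, (U h).dist_map]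
    exact hxε

end Ergodic

/-! ### Displacing finite sets -/

/-- Any finite set of naturals can be moved off any other one by a finite permutation. -/
theorem FinPerm.exists_disjoint_image (I K : Finset ℕ) :
    ∃ h : FinPerm, Disjoint I (K.image (h : Equiv.Perm ℕ)) := by
  obtain ⟨N, hN⟩ : ∃ N, ∀ n ∈ I ∪ K, n < N :=
    ⟨(I ∪ K).sup id + 1, fun n hn => Nat.lt_succ_of_le (Finset.le_sup (f := id) hn)⟩
  -- Interchanges the blocks `[0, N)` and `[N, 2N)`; both `I` and `K` lie in the first.
  let f : ℕ → ℕ := fun n => if n < N then n + N else if n < 2 * N then n - N else n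
  have hf : Function.Involutive f := by
    intro n
    simp only [f]
    split_ifs <;> omega
  refine ⟨⟨hf.toPerm f, (Set.finite_lt_nat (2 * N)).subset fun n hn => ?_⟩, ?_⟩
  · by_contra h
    refine hn ?_
    simp only [Set.mem_ofPred_eq, not_lt] at h
    simp only [Function.Involutive.coe_toPerm, f]
    split_ifs <;> omega
  · rw [Finset.disjoint_left]
    intro n hn hn2
    obtain ⟨k, hk, rfl⟩ := Finset.mem_image.mp hn2
    have h1 := hN _ (Finset.mem_union_left _ hn)
    have h2 := hN k (Finset.mem_union_right _ hk)
    simp only [Function.Involutive.coe_toPerm, f, if_pos h2] at h1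
    omega

/-- It suffices to displace the finite union of the sets `g J`, `g ∈ F`. This is what allows ergodic
averages over only those `g` that separate `J` from `I`. -/
theorem FinPerm.exists_forall_disjoint_image (I J : Finset ℕ) (F : Finset FinPerm) :
    ∃ h : FinPerm, ∀ g ∈ F,
      Disjoint I (J.image ((h * g : FinPerm) : Equiv.Perm ℕ)) := by
  classical
  obtain ⟨h, hh⟩ := FinPerm.exists_disjoint_image I
    (F.biUnion fun g => J.image (g : Equiv.Perm ℕ))
  refine ⟨h, fun g hg => hh.mono_right ?_⟩
  intro n hn
  obtain ⟨j, hj, rfl⟩ := Finset.mem_image.mp hn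
  exact Finset.mem_image.mpr ⟨(g : Equiv.Perm ℕ) j,
    Finset.mem_biUnion.mpr ⟨g, hg, Finset.mem_image_of_mem _ hj⟩, rfl⟩

/-! ### GNS representation and compressions to the invariant vectors -/

section GNSInvariant

open scoped InnerProductSpace

variable {A G : Type*} [CStarAlgebra A] [PartialOrder A] [StarOrderedRing A] [Group G]
  (α : G →* (A ≃⋆ₐ[ℂ] A)) (ω : A →ₚ[ℂ] ℂ) (hω : ω.toLinearMap ∈ invariantStates α)

theorem gnsUnitary_coe (g : G) (a : A) :
    gnsUnitary α ω hω g (ω.toPreGNS a : ω.GNS) = (ω.toPreGNS (α g a) : ω.GNS) :=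
  gnsMap_coe ω (α g) (hω.2 g) a

theorem gnsUnitary_mul (g h : G) (x : ω.GNS) :
    gnsUnitary α ω hω (g * h) x = gnsUnitary α ω hω g (gnsUnitary α ω hω h x) := by
  induction x using UniformSpace.Completion.induction_on with
  | hp => exact isClosed_eq (by fun_prop) (by fun_prop)
  | ih a =>
    rw [← ω.toPreGNS_ofPreGNS a, gnsUnitary_coe, gnsUnitary_coe, gnsUnitary_coe, map_mul]
    rfl

theorem gnsStarAlgHom_coe (a b : A) :
    ω.gnsStarAlgHom a (ω.toPreGNS b : ω.GNS) = (ω.toPreGNS (a * b) : ω.GNS) := by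
  simp

theorem gnsUnitary_gnsStarAlgHom (g : G) (a : A) (x : ω.GNS) :
    gnsUnitary α ω hω g (ω.gnsStarAlgHom a x) =
      ω.gnsStarAlgHom (α g a) (gnsUnitary α ω hω g x) := by
  induction x using UniformSpace.Completion.induction_on with
  | hp => exact isClosed_eq (by fun_prop) (by fun_prop)
  | ih b =>
    rw [← ω.toPreGNS_ofPreGNS b, gnsStarAlgHom_coe, gnsUnitary_coe, gnsUnitary_coe,
      gnsStarAlgHom_coe, map_mul]

theorem inner_gnsStarAlgHom_right (a : A) (x y : ω.GNS) :
    ⟪x, ω.gnsStarAlgHom a y⟫_ℂ = ⟪ω.gnsStarAlgHom (star a) x, y⟫_ℂ := by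
  rw [map_star, ContinuousLinearMap.star_eq_adjoint, ContinuousLinearMap.adjoint_inner_left]

theorem inner_gnsVector_gnsStarAlgHom (a : A) :
    ⟪gnsVector ω, ω.gnsStarAlgHom a (gnsVector ω)⟫_ℂ = ω a := by
  rw [gnsStarAlgHom_gnsVector, gnsVector, UniformSpace.Completion.inner_coe,
    PositiveLinearMap.preGNS_inner_def]
  simp

theorem inner_gnsVector_self : ⟪gnsVector ω, gnsVector ω⟫_ℂ = ω 1 := by
  rw [← inner_gnsVector_gnsStarAlgHom, map_one, one_apply_eq_self]

/-- The cyclic vector is cyclic. -/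
theorem denseRange_gnsStarAlgHom_gnsVector :
    DenseRange fun a => ω.gnsStarAlgHom a (gnsVector ω) := by
  simp only [gnsStarAlgHom_gnsVector]
  exact UniformSpace.Completion.denseRange_coe.comp ω.toPreGNS.surjective.denseRange
    (UniformSpace.Completion.continuous_coe _)

theorem continuous_gnsStarAlgHom : Continuous ω.gnsStarAlgHom :=
  map_continuous ω.gnsStarAlgHom

theorem gnsVector_mem_invariantVectors : gnsVector ω ∈ invariantVectors α ω hω := fun g => by
  rw [gnsVector, gnsUnitary_coe, map_one]

theorem invariantProj_mem (x : ω.GNS) : invariantProj α ω hω x ∈ invariantVectors α ω hω :=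
  Submodule.starProjection_apply_mem _ x

theorem invariantProj_eq_self {x : ω.GNS} (hx : x ∈ invariantVectors α ω hω) :
    invariantProj α ω hω x = x :=
  Submodule.starProjection_eq_self_iff.mpr hx

theorem inner_invariantProj_left (x y : ω.GNS) :
    ⟪invariantProj α ω hω x, y⟫_ℂ = ⟪x, invariantProj α ω hω y⟫_ℂ :=
  Submodule.inner_starProjection_left_eq_right _ x y

theorem inner_invariantProj_of_mem {x : ω.GNS} (hx : x ∈ invariantVectors α ω hω) (y : ω.GNS) :
    ⟪x, invariantProj α ω hω y⟫_ℂ = ⟪x, y⟫_ℂ := by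
  rw [← inner_invariantProj_left, invariantProj_eq_self α ω hω hx]

theorem inner_invariantProj_of_mem_right (x : ω.GNS) {y : ω.GNS}
    (hy : y ∈ invariantVectors α ω hω) :
    ⟪invariantProj α ω hω x, y⟫_ℂ = ⟪x, y⟫_ℂ := by
  rw [inner_invariantProj_left, invariantProj_eq_self α ω hω hy]

/-- If `a` commutes (`ε = 1`) or anticommutes (`ε = -1`) with `α g b` for all `g` in a set
containing a translate of each finite set, then `E π(a) E` and `E π(b) E` commute or anticommute
in the sense of quadratic forms. -/
theorem inner_gnsStarAlgHom_invariantProj (S : Set G)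
    (hS : ∀ F : Finset G, ∃ h, ∀ g ∈ F, h * g ∈ S) (a b : A) (hb : star b = b) (ε : ℂ)
    (hab : ∀ g ∈ S, a * α g b = ε • (α g b * a)) {ζ : ω.GNS}
    (hζ : ζ ∈ invariantVectors α ω hω) :
    ⟪ζ, ω.gnsStarAlgHom a (invariantProj α ω hω (ω.gnsStarAlgHom b ζ))⟫_ℂ =
      ε * ⟪ζ, ω.gnsStarAlgHom b (invariantProj α ω hω (ω.gnsStarAlgHom a ζ))⟫_ℂ := by
  set v := ω.gnsStarAlgHom b ζ with hv
  have hmem := mem_closure_convexHull_image (gnsUnitary α ω hω) (gnsUnitary_mul α ω hω)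
    (v := v) (invariantProj_mem α ω hω v)
    (fun z hz => by
      rw [inner_sub_right, inner_invariantProj_of_mem α ω hω hz, sub_self]) S hS
  -- One side is linear in `x` and the other conjugate-linear, so the condition is only real-linear,
  -- which suffices for real convex hulls. On orbit points it follows from `hab` and selfadjointness
  -- of `α g b`.
  have hsub : closure (convexHull ℝ ((fun g => gnsUnitary α ω hω g v) '' S)) ⊆
      {x | ⟪ζ, ω.gnsStarAlgHom a x⟫_ℂ = ε * ⟪x, ω.gnsStarAlgHom a ζ⟫_ℂ} := by
    refine closure_minimal (convexHull_min ?_ ?_) (isClosed_eq (by fun_prop) (by fun_prop))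
    · rintro _ ⟨g, hg, rfl⟩
      have h1 : gnsUnitary α ω hω g v = ω.gnsStarAlgHom (α g b) ζ := by
        rw [hv, gnsUnitary_gnsStarAlgHom, hζ g]
      have h2 : star (α g b) = α g b := by rw [← map_star, hb]
      simp only [Set.mem_ofPred_eq, h1]
      rw [← mul_apply_eq_comp, ← map_mul, hab g hg, map_smul, map_mul,
        smul_apply, inner_smul_right, mul_apply_eq_comp,
        inner_gnsStarAlgHom_right, h2]
    · intro x hx y hy s t _ _ _
      simp only [Set.mem_ofPred_eq] at hx hy ⊢
      simp only [← Complex.coe_smul, map_add, map_smul, inner_add_right, inner_add_left,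
        inner_smul_right, inner_smul_left, hx, hy, Complex.conj_ofReal]
      ring
  rw [show _ = _ from hsub hmem, inner_invariantProj_left, hv,
    inner_gnsStarAlgHom_right ω b, hb]

/-- By complex polarization an operator with vanishing quadratic form is zero; apply this to the
commutator, whose form depends only on the component of a vector in the range of `E`. -/
theorem compression_comm_of_inner {a b : A}
    (h : ∀ ζ ∈ invariantVectors α ω hω,
      ⟪ζ, ω.gnsStarAlgHom a (invariantProj α ω hω (ω.gnsStarAlgHom b ζ))⟫_ℂ =
        ⟪ζ, ω.gnsStarAlgHom b (invariantProj α ω hω (ω.gnsStarAlgHom a ζ))⟫_ℂ) :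
    Commute (invariantProj α ω hω * ω.gnsStarAlgHom a * invariantProj α ω hω)
      (invariantProj α ω hω * ω.gnsStarAlgHom b * invariantProj α ω hω) := by
  set E := invariantProj α ω hω
  set T := E * ω.gnsStarAlgHom a * E with hT
  set R := E * ω.gnsStarAlgHom b * E with hR
  have hEE : ∀ x, E (E x) = E x := fun x =>
    invariantProj_eq_self α ω hω (invariantProj_mem α ω hω x)
  have key : (T * R - R * T : ω.GNS →L[ℂ] ω.GNS).toLinearMap = 0 := by
    rw [← inner_map_self_eq_zero]
    intro x
    have h1 := h (E x) (invariantProj_mem α ω hω x)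
    have h2 : ⟪x, (T * R - R * T) x⟫_ℂ = 0 := by
      simp only [hT, hR, sub_apply, mul_apply_eq_comp, hEE,
        inner_sub_right]
      rw [← inner_invariantProj_left, ← inner_invariantProj_left]
      exact sub_eq_zero.mpr h1
    rw [← inner_conj_symm]
    exact (congrArg _ h2).trans (map_zero _)
  have key2 : T * R - R * T = 0 := by
    ext x
    exact congrArg (fun L : ω.GNS →ₗ[ℂ] ω.GNS => L x) key
  exact sub_eq_zero.mp key2

end GNSInvariant

/-! ### Homogeneous local elements, evenness and commutativity -/

/-- A star-closed subspace lies in a subspace containing all its selfadjoint elements. -/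
theorem Submodule.le_of_forall_star_eq {A : Type*} [CStarAlgebra A] {L P : Submodule ℂ A}
    (hL : ∀ b ∈ L, star b ∈ L) (h : ∀ b ∈ L, star b = b → b ∈ P) : L ≤ P := by
  intro b hb
  have hx := h (b + star b) (L.add_mem hb (hL b hb)) (by simp [add_comm])
  have hy := h (Complex.I • (b - star b))
    (L.smul_mem _ (L.sub_mem hb (hL b hb))) (by
      simp only [star_smul, star_sub, star_star, Complex.star_def, Complex.conj_I]
      module)
  have h2 : b = (2⁻¹ : ℂ) • ((b + star b) - Complex.I • (Complex.I • (b - star b))) := by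
    rw [smul_smul, Complex.I_mul_I]
    module
  rw [h2]
  exact P.smul_mem _ (P.sub_mem hx (P.smul_mem _ hy))

namespace QuasiLocal

section

variable {A : Type*} [CStarAlgebra A] (Q : QuasiLocal A)

/-- The elements of `Q.loc J` that `θ` multiplies by `ε`: the even ones for `ε = 1`, the odd ones
for `ε = -1`. -/
def homogeneous (J : Finset ℕ) (ε : ℂ) : Submodule ℂ A where
  carrier := {b | b ∈ Q.loc J ∧ Q.θ b = ε • b}
  add_mem' {x y} hx hy := ⟨add_mem hx.1 hy.1, by rw [map_add, hx.2, hy.2, smul_add]⟩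
  zero_mem' := ⟨zero_mem _, by simp⟩
  smul_mem' c x hx := ⟨SMulMemClass.smul_mem c hx.1, by rw [map_smul, hx.2, smul_comm]⟩

theorem star_mem_homogeneous {J : Finset ℕ} {ε : ℂ} (hε : star ε = ε) (b : A)
    (hb : b ∈ Q.homogeneous J ε) : star b ∈ Q.homogeneous J ε :=
  ⟨star_mem hb.1, by rw [map_star, hb.2, star_smul, hε]⟩

/-- A closed subspace containing all local homogeneous elements is everything. -/
theorem mem_of_homogeneous_le {P : Submodule ℂ A} (hP : IsClosed (P : Set A))
    (heven : ∀ J, Q.homogeneous J 1 ≤ P) (hodd : ∀ J, Q.homogeneous J (-1) ≤ P) (a : A) :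
    a ∈ P := by
  have hsub : (⋃ J, (Q.loc J : Set A)) ⊆ P := by
    rintro b hb
    obtain ⟨J, hb⟩ := Set.mem_iUnion.mp hb
    have hθ : Q.θ b ∈ Q.loc J := by
      have h : Q.θ b ∈ (Q.loc J : Set A) := Q.θ_image_loc J ▸ Set.mem_image_of_mem _ hb
      exact h
    have h1 : b + Q.θ b ∈ P := heven J
      ⟨add_mem hb hθ, by rw [map_add, Q.θ_involutive, one_smul, add_comm]⟩
    have h2 : b - Q.θ b ∈ P := hodd J
      ⟨sub_mem hb hθ, by rw [map_sub, Q.θ_involutive]; module⟩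
    have h3 : b = (2⁻¹ : ℂ) • ((b + Q.θ b) + (b - Q.θ b)) := by module
    rw [h3]
    exact P.smul_mem _ (P.add_mem h1 h2)
  have h := (Q.dense_iUnion_loc.mono hsub) a
  rwa [hP.closure_eq] at h

variable {Q} {α : FinPerm →* (A ≃⋆ₐ[ℂ] A)}

theorem IsLocalAction.map_mem_homogeneous (hα : Q.IsLocalAction α) {J : Finset ℕ} {ε : ℂ} {b : A}
    (hb : b ∈ Q.homogeneous J ε) (g : FinPerm) :
    α g b ∈ Q.homogeneous (J.image (g : Equiv.Perm ℕ)) ε := by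
  refine ⟨?_, by rw [← hα.equivariant, hb.2, map_smul]⟩
  have h : α g b ∈ (Q.loc (J.image (g : Equiv.Perm ℕ)) : Set A) :=
    hα.image_loc g J ▸ Set.mem_image_of_mem _ hb.1
  exact h

end

variable {A : Type*} [CStarAlgebra A] [PartialOrder A] [StarOrderedRing A] {Q : QuasiLocal A}
  {α : FinPerm →* (A ≃⋆ₐ[ℂ] A)}

open scoped InnerProductSpace

namespace IsLocalAction

/-- A selfadjoint odd `b` anticommutes with its displaced translates, so `‖E π(b) ζ‖²` equals its
own negative. General odd elements are combinations of selfadjoint ones. -/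
theorem invariantProj_odd (hα : Q.IsLocalAction α) (ω : A →ₚ[ℂ] ℂ)
    (hω : ω.toLinearMap ∈ invariantStates α) {J : Finset ℕ} {b : A}
    (hb : b ∈ Q.homogeneous J (-1)) {ζ : ω.GNS} (hζ : ζ ∈ invariantVectors α ω hω) :
    invariantProj α ω hω (ω.gnsStarAlgHom b ζ) = 0 := by
  let L : A →ₗ[ℂ] ω.GNS :=
    { toFun := fun b => invariantProj α ω hω (ω.gnsStarAlgHom b ζ)
      map_add' := fun x y => by rw [map_add, add_apply, map_add]
      map_smul' := fun c x => by rw [map_smul, smul_apply, map_smul]; rfl }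
  refine Submodule.le_of_forall_star_eq (P := L.ker)
    (Q.star_mem_homogeneous (by simp)) (fun b hb hsa => ?_) hb
  have h := inner_gnsStarAlgHom_invariantProj α ω hω
    {g : FinPerm | Disjoint J (J.image (g : Equiv.Perm ℕ))}
    (FinPerm.exists_forall_disjoint_image J J) b b hsa (-1) (fun g hg => by
      have hg2 := hα.map_mem_homogeneous hb g
      rw [neg_one_smul]
      exact Q.anticomm_of_odd _ _ hg b hb.1 _ hg2.1 (by rw [hb.2, neg_one_smul])
        (by rw [hg2.2, neg_one_smul])) hζ
  rw [inner_gnsStarAlgHom_right, hsa, ← inner_invariantProj_of_mem_right α ω hω _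
    (invariantProj_mem α ω hω _), neg_one_mul, self_eq_neg, inner_self_eq_zero] at h
  exact h

/-- Invariant states are even. -/
theorem apply_θ (hα : Q.IsLocalAction α) (ω : A →ₚ[ℂ] ℂ)
    (hω : ω.toLinearMap ∈ invariantStates α) (a : A) : ω (Q.θ a) = ω a := by
  have hcont : Continuous Q.θ := map_continuous Q.θ
  have hcω : Continuous ω := map_continuous ω
  refine Q.mem_of_homogeneous_le
    (P := LinearMap.eqLocus (ω.toLinearMap ∘ₗ (Q.θ : A ≃⋆ₐ[ℂ] A).toAlgEquiv.toLinearMap)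
      ω.toLinearMap)
    (isClosed_eq (hcω.comp hcont) hcω) ?_ ?_ a
  · intro J b hb
    change ω (Q.θ b) = ω b
    rw [hb.2, one_smul]
  · intro J b hb
    have hξ := gnsVector_mem_invariantVectors α ω hω
    have h0 : ω b = 0 := by
      rw [← inner_gnsVector_gnsStarAlgHom, ← inner_invariantProj_of_mem α ω hω hξ,
        hα.invariantProj_odd ω hω hb hξ, inner_zero_right]
    change ω (Q.θ b) = ω b
    rw [hb.2, map_smul, h0, smul_zero]

/-- The operators `E π(a) E` commute. -/
theorem commute_compression (hα : Q.IsLocalAction α) (ω : A →ₚ[ℂ] ℂ)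
    (hω : ω.toLinearMap ∈ invariantStates α) (a b : A) :
    Commute (invariantProj α ω hω * ω.gnsStarAlgHom a * invariantProj α ω hω)
      (invariantProj α ω hω * ω.gnsStarAlgHom b * invariantProj α ω hω) := by
  let E := invariantProj α ω hω
  let L : A →ₗ[ℂ] (ω.GNS →L[ℂ] ω.GNS) :=
    { toFun := fun a => E * ω.gnsStarAlgHom a * E
      map_add' := fun x y => by rw [map_add, mul_add, add_mul]
      map_smul' := fun c x => by rw [map_smul, mul_smul_comm, smul_mul_assoc]; rfl }
  have hL : Continuous L :=
    (continuous_const.mul (continuous_gnsStarAlgHom ω)).mul continuous_const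
  have hLodd : ∀ J, ∀ b ∈ Q.homogeneous J (-1), L b = 0 := fun J b hb => by
    ext x
    exact hα.invariantProj_odd ω hω hb (invariantProj_mem α ω hω x)
  -- The elements whose compressions commute with those of `X`. Being a closed subspace, `P X` can
  -- be shown to be everything on homogeneous local elements, first in one argument and then in the
  -- other.
  let P : Set A → Submodule ℂ A := fun X =>
    (Subalgebra.toSubmodule (Subalgebra.centralizer ℂ (L '' X))).comap L
  have hP : ∀ X, IsClosed (P X : Set A) := fun X =>
    (Set.isClosed_centralizer (L '' X)).preimage hL
  have hmem : ∀ X c, c ∈ P X ↔ ∀ d ∈ X, Commute (L d) (L c) := fun X c => by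
    simp [P, Subalgebra.mem_centralizer_iff, Commute, SemiconjBy]
  have hPodd : ∀ X J, Q.homogeneous J (-1) ≤ P X := fun X J c hc => by
    rw [hmem]
    intro d _
    rw [hLodd J c hc]
    exact Commute.zero_right _
  have heven : ∀ I, ∀ c ∈ Q.homogeneous I 1, ∀ d, d ∈ P {c} := fun I c hc => by
    refine Q.mem_of_homogeneous_le (hP _) (fun J => ?_) (hPodd _)
    refine Submodule.le_of_forall_star_eq (Q.star_mem_homogeneous (by simp))
      fun d hd hsa => ?_
    rw [hmem]
    simp only [Set.mem_singleton_iff, forall_eq]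
    refine compression_comm_of_inner α ω hω fun ζ hζ => ?_
    have h := inner_gnsStarAlgHom_invariantProj α ω hω
      {g : FinPerm | Disjoint I (J.image (g : Equiv.Perm ℕ))}
      (FinPerm.exists_forall_disjoint_image I J) c d hsa 1 (fun g hg => by
        have hg2 := hα.map_mem_homogeneous hd g
        have e1 := hc.2
        have e2 := hg2.2
        rw [one_smul] at e1 e2 ⊢
        exact Q.comm_of_even _ _ hg c hc.1 _ hg2.1 (.inl e1) (.inl e2) (.inl e1)) hζ
    rwa [one_mul] at h
  have hall : b ∈ P Set.univ := by
    refine Q.mem_of_homogeneous_le (hP _) (fun J c hc => ?_) (hPodd _) b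
    rw [hmem]
    intro d _
    exact ((hmem _ _).mp (heven J c hc d) c rfl).symm
  exact (hmem _ _).mp hall a trivial

end IsLocalAction

end QuasiLocal

/-! ### Extremality and the dimension of the invariant vectors -/

section Extreme

open scoped InnerProductSpace

variable {A G : Type*} [CStarAlgebra A] [PartialOrder A] [StarOrderedRing A] [Group G]

theorem eq_of_inner_gnsStarAlgHom (ω : A →ₚ[ℂ] ℂ) {x y : ω.GNS}
    (h : ∀ a, ⟪x, ω.gnsStarAlgHom a (gnsVector ω)⟫_ℂ =
      ⟪y, ω.gnsStarAlgHom a (gnsVector ω)⟫_ℂ) : x = y := by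
  refine ext_inner_right ℂ fun z => ?_
  exact congrFun (DenseRange.equalizer (g := fun z => ⟪x, z⟫_ℂ) (h := fun z => ⟪y, z⟫_ℂ)
    (denseRange_gnsStarAlgHom_gnsVector ω) (by fun_prop) (by fun_prop) (funext h)) z

/-- A positive functional dominated by a multiple of `ω` is represented by a vector of the GNS
space of `ω`. -/
theorem exists_inner_gnsStarAlgHom_eq (φ ω : A →ₚ[ℂ] ℂ) {C : ℝ} (hC : 0 ≤ C)
    (h : ∀ a, 0 ≤ a → φ a ≤ C * ω a) :
    ∃ η : ω.GNS, ∀ a, ⟪η, ω.gnsStarAlgHom a (gnsVector ω)⟫_ℂ = φ a := by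
  have hnorm : ∀ a, ‖φ.toPreGNS a‖ ≤ √C * ‖ω.toPreGNS a‖ := fun a => by
    rw [← sq_le_sq₀ (by positivity) (by positivity), mul_pow, Real.sq_sqrt hC,
      ← Complex.real_le_real]
    push_cast
    rw [PositiveLinearMap.preGNS_norm_sq, PositiveLinearMap.preGNS_norm_sq]
    exact h _ (star_mul_self_nonneg _)
  -- The bound is Cauchy–Schwarz for `φ` applied to `1` and `x`, followed by domination by `ω`.
  let f : ω.PreGNS →L[ℂ] ℂ :=
    (φ.toLinearMap ∘ₗ ω.ofPreGNS.toLinearMap).mkContinuous (‖φ.toPreGNS 1‖ * √C) fun x => by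
      have h1 := norm_inner_le_norm (𝕜 := ℂ) (φ.toPreGNS 1) (φ.toPreGNS (ω.ofPreGNS x))
      rw [PositiveLinearMap.preGNS_inner_def] at h1
      simp only [PositiveLinearMap.ofPreGNS_toPreGNS, star_one, one_mul] at h1
      refine h1.trans ?_
      rw [mul_assoc]
      exact mul_le_mul_of_nonneg_left (hnorm _) (norm_nonneg _)
  let F : ω.GNS →L[ℂ] ℂ := f.extend (UniformSpace.Completion.toComplL (𝕜 := ℂ) (E := ω.PreGNS))
  refine ⟨(InnerProductSpace.toDual ℂ ω.GNS).symm F, fun a => ?_⟩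
  rw [InnerProductSpace.toDual_symm_apply, gnsStarAlgHom_gnsVector]
  exact ContinuousLinearMap.extend_eq f UniformSpace.Completion.denseRange_coe
    (UniformSpace.Completion.isUniformInducing_coe _) (ω.toPreGNS a)

variable (α : G →* (A ≃⋆ₐ[ℂ] A)) (ω : A →ₚ[ℂ] ℂ) (hω : ω.toLinearMap ∈ invariantStates α)

theorem gnsVector_ne_zero (hω1 : ω 1 = 1) : gnsVector ω ≠ 0 := fun h => by
  have h1 := inner_gnsVector_self ω
  rw [h, inner_zero_left, hω1] at h1
  exact zero_ne_one h1

/-- From `s φ ≤ ω` the component `φ` is represented by a vector, which is invariant by uniqueness.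
It is therefore a multiple of `ξ`, and normalization makes the multiple `1`. -/
theorem mem_extremePoints_of_finrank_eq_one
    (hdim : Module.finrank ℂ (invariantVectors α ω hω) = 1) :
    ω.toLinearMap ∈ Set.extremePoints ℝ (invariantStates α) := by
  rw [mem_extremePoints_iff_left]
  refine ⟨hω, ?_⟩
  rintro φ hφ ψ hψ ⟨s, t, hs, ht, -, heq⟩
  have hsum : ∀ a, (s : ℂ) * φ a + t * ψ a = ω a := fun a =>
    congrArg (fun L : A →ₗ[ℂ] ℂ => L a) heq
  let Φ : A →ₚ[ℂ] ℂ := PositiveLinearMap.mk₀ φ hφ.1.1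
  obtain ⟨η, hη⟩ := exists_inner_gnsStarAlgHom_eq Φ ω (C := s⁻¹) (by positivity) fun a ha => by
    have h1 : (0 : ℂ) ≤ (t : ℂ) * ψ a :=
      mul_nonneg (by exact_mod_cast ht.le) (hψ.1.1 a ha)
    have h2 : (0 : ℂ) ≤ ((s⁻¹ : ℝ) : ℂ) := by exact_mod_cast (inv_pos.mpr hs).le
    have h3 : (s : ℂ) ≠ 0 := by exact_mod_cast hs.ne'
    have h4 : Φ a = ((s⁻¹ : ℝ) : ℂ) * (s * φ a) := by
      push_cast
      rw [inv_mul_cancel_left₀ h3]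
      rfl
    rw [h4, ← hsum a]
    exact mul_le_mul_of_nonneg_left (le_add_of_nonneg_right h1) h2
  have hηinv : η ∈ invariantVectors α ω hω := fun g => by
    refine eq_of_inner_gnsStarAlgHom ω fun a => ?_
    obtain ⟨b, rfl⟩ : ∃ b, α g b = a := (α g).surjective a
    rw [← gnsUnitary_apply α ω hω, LinearIsometryEquiv.inner_map_map, gnsUnitary_apply, hη, hη]
    exact (hφ.2 g b).symm
  obtain ⟨c, hc⟩ := (finrank_eq_one_iff_of_nonzero'
    (⟨gnsVector ω, gnsVector_mem_invariantVectors α ω hω⟩ : invariantVectors α ω hω)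
    (fun h => gnsVector_ne_zero ω hω.1.2 (congrArg Subtype.val h))).mp hdim ⟨η, hηinv⟩
  have hc' : c • gnsVector ω = η := congrArg Subtype.val hc
  have hφc : ∀ a, φ a = star c * ω a := fun a => by
    have h1 := hη a
    rw [← hc', inner_smul_left, inner_gnsVector_gnsStarAlgHom] at h1
    exact h1.symm
  have hc1 : star c = 1 := by
    have h1 := hφc 1
    rw [hφ.1.2, show ω 1 = 1 from hω.1.2, mul_one] at h1
    exact h1.symm
  ext a
  rw [hφc, hc1, one_mul]
  rfl

/-- The functional `a ↦ ⟪E π(c) ξ, π(a) ξ⟫`. -/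
noncomputable def compressionFunctional (c : A) : A →ₗ[ℂ] ℂ where
  toFun a := ⟪invariantProj α ω hω (ω.gnsStarAlgHom c (gnsVector ω)),
    ω.gnsStarAlgHom a (gnsVector ω)⟫_ℂ
  map_add' a b := by rw [map_add, add_apply, inner_add_right]
  map_smul' r a := by rw [map_smul, smul_apply, inner_smul_right]; rfl

theorem compressionFunctional_apply (c a : A) :
    compressionFunctional α ω hω c a =
      ⟪invariantProj α ω hω (ω.gnsStarAlgHom c (gnsVector ω)),
        ω.gnsStarAlgHom a (gnsVector ω)⟫_ℂ := rfl

theorem compressionFunctional_map (c a : A) (g : G) :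
    compressionFunctional α ω hω c (α g a) = compressionFunctional α ω hω c a := by
  rw [compressionFunctional_apply, compressionFunctional_apply, ← gnsUnitary_apply α ω hω]
  conv_lhs => rw [← invariantProj_mem α ω hω _ g]
  rw [LinearIsometryEquiv.inner_map_map]

theorem compressionFunctional_one {c : A} (hc : star c = c) :
    compressionFunctional α ω hω c 1 = ω c := by
  rw [compressionFunctional_apply, map_one, one_apply_eq_self,
    inner_invariantProj_of_mem_right α ω hω _ (gnsVector_mem_invariantVectors α ω hω),
    ← inner_gnsVector_gnsStarAlgHom, inner_gnsStarAlgHom_right, hc]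

theorem compressionFunctional_add_one_sub (c a : A) :
    compressionFunctional α ω hω c a + compressionFunctional α ω hω (1 - c) a = ω a := by
  rw [compressionFunctional_apply, compressionFunctional_apply, ← inner_add_left, ← map_add,
    ← add_apply, ← map_add, add_sub_cancel, map_one, one_apply_eq_self,
    invariantProj_eq_self α ω hω (gnsVector_mem_invariantVectors α ω hω),
    inner_gnsVector_gnsStarAlgHom]

/-- The value is the expectation in `ξ` of the product of `E π(c) E` and `E π(a) E`. This is the
point where commutativity is used: commuting positive operators have a positive product. -/
theorem compressionFunctional_nonneg
    (hcomm : ∀ a b : A,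
      Commute (invariantProj α ω hω * ω.gnsStarAlgHom a * invariantProj α ω hω)
        (invariantProj α ω hω * ω.gnsStarAlgHom b * invariantProj α ω hω)) {c a : A} (hc : 0 ≤ c) (ha : 0 ≤ a) :
    0 ≤ compressionFunctional α ω hω c a := by
  have hE : star (invariantProj α ω hω) = invariantProj α ω hω :=
    (isSelfAdjoint_starProjection _).star_eq
  have hpos : ∀ b : A, 0 ≤ b →
      0 ≤ invariantProj α ω hω * ω.gnsStarAlgHom b * invariantProj α ω hω := fun b hb => by
    have h := star_left_conjugate_nonneg (map_nonneg ω.gnsStarAlgHom hb) (invariantProj α ω hω)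
    rwa [hE] at h
  have h := (hcomm c a).mul_nonneg (hpos c hc) (hpos a ha)
  rw [ContinuousLinearMap.nonneg_iff_isPositive] at h
  have h2 := h.inner_nonneg_right (gnsVector ω)
  have hξ := gnsVector_mem_invariantVectors α ω hω
  have hcs : star c = c := (IsSelfAdjoint.of_nonneg hc).star_eq
  simp only [mul_apply_eq_comp, invariantProj_eq_self α ω hω hξ,
    invariantProj_eq_self α ω hω (invariantProj_mem α ω hω _)] at h2
  rwa [inner_invariantProj_of_mem α ω hω hξ, inner_gnsStarAlgHom_right, hcs,
    ← inner_invariantProj_left] at h2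

/-- The functionals of `c` and `1 - c` sum to `ω` and, divided by `s` and `1 - s`, are invariant
states. Extremality identifies the first with `ω`, and the representing vector is unique. -/
theorem invariantProj_gnsStarAlgHom_of_mem_extremePoints
    (hcomm : ∀ a b : A,
      Commute (invariantProj α ω hω * ω.gnsStarAlgHom a * invariantProj α ω hω)
        (invariantProj α ω hω * ω.gnsStarAlgHom b * invariantProj α ω hω))
    (hext : ω.toLinearMap ∈ Set.extremePoints ℝ (invariantStates α)) {c : A} (hc0 : 0 ≤ c)
    (hc1 : 0 ≤ 1 - c) {s : ℝ} (hs : ω c = s) (hs0 : 0 < s) (hs1 : s < 1) :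
    invariantProj α ω hω (ω.gnsStarAlgHom c (gnsVector ω)) = (s : ℂ) • gnsVector ω := by
  have hstate : ∀ d : A, 0 ≤ d → ∀ r : ℝ, 0 < r → ω d = r →
      ((r : ℂ)⁻¹ • compressionFunctional α ω hω d) ∈ invariantStates α := by
    intro d hd r hr hrd
    have hr' : (r : ℂ) ≠ 0 := by exact_mod_cast hr.ne'
    refine ⟨⟨fun a ha => ?_, ?_⟩, fun g a => ?_⟩
    · have h1 : (0 : ℂ) ≤ (r : ℂ)⁻¹ := by exact_mod_cast (inv_pos.mpr hr).le
      exact mul_nonneg h1 (compressionFunctional_nonneg α ω hω hcomm hd ha)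
    · rw [LinearMap.smul_apply,
        compressionFunctional_one α ω hω (IsSelfAdjoint.of_nonneg hd).star_eq, hrd, smul_eq_mul,
        inv_mul_cancel₀ hr']
    · rw [LinearMap.smul_apply, LinearMap.smul_apply, compressionFunctional_map]
  have h1s : ω (1 - c) = ((1 - s : ℝ) : ℂ) := by
    rw [map_sub, hs, show ω 1 = 1 from hω.1.2]
    push_cast
    rfl
  have hs' : (s : ℂ) ≠ 0 := by exact_mod_cast hs0.ne'
  have hs1' : ((1 - s : ℝ) : ℂ) ≠ 0 := by exact_mod_cast (sub_pos.mpr hs1).ne'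
  have heq := hext.2 (hstate c hc0 s hs0 hs) (hstate (1 - c) hc1 (1 - s) (sub_pos.mpr hs1) h1s)
    ⟨s, 1 - s, hs0, sub_pos.mpr hs1, by ring, by
      ext a
      rw [← Complex.coe_smul, ← Complex.coe_smul, smul_inv_smul₀ hs', smul_inv_smul₀ hs1']
      exact compressionFunctional_add_one_sub α ω hω c a⟩
  refine eq_of_inner_gnsStarAlgHom ω fun a => ?_
  have h2 : (s : ℂ)⁻¹ * compressionFunctional α ω hω c a = ω a :=
    congrArg (fun L : A →ₗ[ℂ] ℂ => L a) heq
  rw [inner_smul_left, inner_gnsVector_gnsStarAlgHom, Complex.conj_ofReal, ← h2,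
    mul_inv_cancel_left₀ hs']
  rfl

theorem finrank_eq_one_of_mem_extremePoints
    (hcomm : ∀ a b : A,
      Commute (invariantProj α ω hω * ω.gnsStarAlgHom a * invariantProj α ω hω)
        (invariantProj α ω hω * ω.gnsStarAlgHom b * invariantProj α ω hω))
    (hext : ω.toLinearMap ∈ Set.extremePoints ℝ (invariantStates α)) :
    Module.finrank ℂ (invariantVectors α ω hω) = 1 := by
  set ξ := gnsVector ω
  have hξ := gnsVector_mem_invariantVectors α ω hω
  let L : A →ₗ[ℂ] ω.GNS :=
    { toFun := fun b => invariantProj α ω hω (ω.gnsStarAlgHom b ξ)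
      map_add' := fun x y => by rw [map_add, add_apply, map_add]
      map_smul' := fun c x => by rw [map_smul, smul_apply, map_smul]; rfl }
  let P : Submodule ℂ A := (ℂ ∙ ξ).comap L
  have h1P : (1 : A) ∈ P := by
    change invariantProj α ω hω (ω.gnsStarAlgHom 1 ξ) ∈ ℂ ∙ ξ
    rw [map_one, one_apply_eq_self, invariantProj_eq_self α ω hω hξ]
    exact Submodule.mem_span_singleton_self ξ
  have hpos : ∀ b : A, 0 ≤ b → b ∈ P := by
    intro b hb
    -- With `c = k (b + 1)` one has `0 ≤ c ≤ 1`. The shift by `1` and the `2` in place of `1` make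
    -- `0 < ω c < 1` strict, so no degenerate case arises.
    set k : ℝ := (‖b‖ + 2)⁻¹
    have hk0 : 0 < k := by positivity
    have hk1 : k * (‖b‖ + 2) = 1 := inv_mul_cancel₀ (by positivity)
    have hle : b ≤ algebraMap ℝ A ‖b‖ := (IsSelfAdjoint.of_nonneg hb).le_algebraMap_norm_self
    have hωalg : ω (algebraMap ℝ A ‖b‖) = (‖b‖ : ℂ) := by
      rw [Algebra.algebraMap_eq_smul_one, ← Complex.coe_smul, map_smul,
        show ω 1 = 1 from hω.1.2, smul_eq_mul, mul_one]
    have hωb0 : 0 ≤ ω b := map_nonneg ω hb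
    have hωb1 : ω b ≤ (‖b‖ : ℂ) := hωalg ▸ OrderHomClass.mono ω hle
    obtain ⟨r, hr⟩ : ∃ r : ℝ, ω b = r := ⟨(ω b).re, Complex.eq_re_of_ofReal_le hωb0⟩
    rw [hr] at hωb0 hωb1
    have hr0 : 0 ≤ r := by exact_mod_cast hωb0
    have hr1 : r ≤ ‖b‖ := by exact_mod_cast hωb1
    have hc0 : 0 ≤ k • (b + 1) := smul_nonneg hk0.le (add_nonneg hb zero_le_one)
    have hc1 : 0 ≤ 1 - k • (b + 1) := by
      have h1 : 1 - k • (b + 1) = k • ((algebraMap ℝ A ‖b‖ - b) + 1) := by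
        have h2 : (1 : A) = (k * (‖b‖ + 2)) • (1 : A) := by rw [hk1, one_smul]
        rw [Algebra.algebraMap_eq_smul_one, sub_eq_iff_eq_add]
        refine h2.trans ?_
        clear_value k
        module
      rw [h1]
      exact smul_nonneg hk0.le (add_nonneg (sub_nonneg.mpr hle) zero_le_one)
    have hωc : ω (k • (b + 1)) = ((k * (r + 1) : ℝ) : ℂ) := by
      rw [← Complex.coe_smul, map_smul, map_add, hr, show ω 1 = 1 from hω.1.2]
      push_cast
      rfl
    have hcP : k • (b + 1) ∈ P := by
      change invariantProj α ω hω (ω.gnsStarAlgHom _ ξ) ∈ ℂ ∙ ξ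
      rw [invariantProj_gnsStarAlgHom_of_mem_extremePoints α ω hω hcomm hext hc0 hc1 hωc
        (by positivity) (by nlinarith)]
      exact Submodule.mem_span_singleton.mpr ⟨_, rfl⟩
    have hb2 : b = ((k⁻¹ : ℝ) : ℂ) • (k • (b + 1)) - 1 := by
      rw [Complex.coe_smul, inv_smul_smul₀ hk0.ne', add_sub_cancel_right]
    rw [hb2]
    exact P.sub_mem (P.smul_mem _ hcP) h1P
  have hP : P = ⊤ := by
    rw [eq_top_iff, ← CStarAlgebra.span_nonneg, Submodule.span_le]
    exact hpos
  -- `E` sends the dense set `π(A) ξ` into the closed line `ℂ ξ`, hence sends everything there.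
  have hspan : invariantVectors α ω hω = ℂ ∙ ξ := by
    refine le_antisymm (fun ζ hζ => ?_) ((Submodule.span_singleton_le_iff_mem _ _).mpr hξ)
    have hclosed : IsClosed {x | invariantProj α ω hω x ∈ ℂ ∙ ξ} :=
      (Submodule.closed_of_finiteDimensional (ℂ ∙ ξ)).preimage (invariantProj α ω hω).continuous
    have h1 : invariantProj α ω hω ζ ∈ ℂ ∙ ξ :=
      (denseRange_gnsStarAlgHom_gnsVector ω).induction_on
        (p := fun x => invariantProj α ω hω x ∈ ℂ ∙ ξ) ζ hclosed fun a => by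
          have h2 : a ∈ P := hP ▸ Submodule.mem_top
          exact h2
    rwa [invariantProj_eq_self α ω hω hζ] at h1
  rw [hspan]
  exact finrank_span_singleton (gnsVector_ne_zero ω hω.1.2)

end Extreme

theorem mainTheorem7 {A : Type*} [CStarAlgebra A] [PartialOrder A] [StarOrderedRing A]
    (Q : QuasiLocal A) (α : FinPerm →* (A ≃⋆ₐ[ℂ] A)) (hα : Q.IsLocalAction α) :
    (∀ (ω : A →ₚ[ℂ] ℂ) (hω : ω.toLinearMap ∈ invariantStates α),
      (∀ a, ω (Q.θ a) = ω a) ∧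
      (∀ S ∈ compressedFamily α ω hω, ∀ T ∈ compressedFamily α ω hω, S * T = T * S) ∧
      (ω.toLinearMap ∈ Set.extremePoints ℝ (invariantStates α) ↔
        Module.finrank ℂ (invariantVectors α ω hω) = 1)) ∧
    IsGAbelian α := by
  have hab : IsGAbelian α := by
    rintro ω hω _ ⟨a, rfl⟩ _ ⟨b, rfl⟩
    exact hα.commute_compression ω hω a b
  exact ⟨fun ω hω => ⟨hα.apply_θ ω hω, hab ω hω,
    finrank_eq_one_of_mem_extremePoints α ω hω (hα.commute_compression ω hω),
    mem_extremePoints_of_finrank_eq_one α ω hω⟩, hab⟩
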